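/- Let $\Gamma$ be a finite metric graph, i.e. a metrizable CW complex with finitely many cells, all of dimension at most $1$, together with a length $\ell(e)>0$ for every edge ($1$-cell) $e$; loops, multiple edges and several components are allowed. The length of an edge path is the sum of the lengths of its edges, counted with multiplicity. Assume that $\Gamma$ has at least one edge. Let $f:\Gamma\to\Gamma$ be a graph map: $f$ is continuous, sends vertices to vertices, and sends each edge $e$ to an edge path $f(e)$, that is, $f$ restricted to $e$ runs along the (possibly backtracking) edge path $f(e)$ up to a continuous monotone change of parameter. Let $\lambda>0$ be a real algebraic integer and suppose that $f$ is uniformly $\lambda$-expanding, i.e. $\ell(f(e))=\lambda\,\ell(e)$ for every edge $e$ of $\Gamma$. Then the topological entropy of $f$ is \[ h(f)=\lim_{\varepsilon\to 0}\,\limsup_{n\to\infty}\frac1n\log N(\varepsilon,n)=\log\lambda , \] where, for any metric $d$ inducing the topology of $\Gamma$, $N(\varepsilon,n)$ is the least number of balls of radius $\varepsilon$ for the metric $d_n(x,y)=\max_{0\le j\le n-1}d(f^j(x),f^j(y))$ that cover $\Gamma$. -/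

import Mathlib

open Set Topology

noncomputable section

namespace MetricGraphEntropy

/-- A finite graph: a CW complex with finitely many cells, all of dimension at most `1`. The
`0`-cells are the vertices and the `1`-cells are the edges; loops, multiple edges, isolated
vertices and several components are allowed. -/
class IsFiniteGraph (X : Type*) [TopologicalSpace X] [CWComplex (univ : Set X)] : Prop where
  finite : RelCWComplex.Finite (univ : Set X)
  isEmpty_cell : ∀ n : ℕ, 2 ≤ n → IsEmpty (RelCWComplex.cell (univ : Set X) n)

/-- The edges of a graph. -/
abbrev Edge (X : Type*) [TopologicalSpace X] [CWComplex (univ : Set X)] : Type _ :=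
  RelCWComplex.cell (univ : Set X) 1

/-- The set of vertices of a graph, as points of the graph. -/
def vertices (X : Type*) [TopologicalSpace X] [CWComplex (univ : Set X)] : Set X :=
  ⋃ v : RelCWComplex.cell (univ : Set X) 0, RelCWComplex.closedCell 0 v

/-- An edge together with one of its two orientations; `true` is the orientation given by the
characteristic map of the edge. -/
abbrev OrientedEdge (X : Type*) [TopologicalSpace X] [CWComplex (univ : Set X)] : Type _ :=
  Edge X × Bool

/-- The characteristic map of an edge, as a function of a real parameter in `[-1, 1]`. -/
def edgeMap {X : Type*} [TopologicalSpace X] [CWComplex (univ : Set X)] (e : Edge X) (t : ℝ) : X :=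
  RelCWComplex.map (C := (univ : Set X)) 1 e (fun _ => t)

/-- The parametrization of an oriented edge by `[-1, 1]`, starting at its initial vertex. -/
def OrientedEdge.param {X : Type*} [TopologicalSpace X] [CWComplex (univ : Set X)]
    (d : OrientedEdge X) (t : ℝ) : X :=
  if d.2 then edgeMap d.1 t else edgeMap d.1 (-t)

/-- `Traverses γ a b w`: on the interval `[a, b]`, the curve `γ` runs along the edge path
`w = d₁ d₂ … dₖ`, that is, it runs once through `d₁` from its beginning to its end, then once
through `d₂`, and so on, each time up to a continuous monotone (not necessarily injective, not
necessarily affine) change of parameter. The empty edge path is a constant curve at a vertex.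
As `γ` is a function, the end of each `dᵢ` is automatically the beginning of the next one; the
list `w` is determined by `γ`, `a` and `b`. Edge paths may backtrack. -/
inductive Traverses {X : Type*} [TopologicalSpace X] [CWComplex (univ : Set X)] (γ : ℝ → X) :
    ℝ → ℝ → List (OrientedEdge X) → Prop
  | nil {a b : ℝ} {v : X} (hab : a ≤ b) (hv : v ∈ vertices X) (hγ : ∀ t ∈ Icc a b, γ t = v) :
      Traverses γ a b []
  | cons {a b c : ℝ} {d : OrientedEdge X} {w : List (OrientedEdge X)} (s : ℝ → ℝ) (hac : a < c)
      (s_mono : MonotoneOn s (Icc a c)) (s_cont : ContinuousOn s (Icc a c))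
      (s_left : s a = -1) (s_right : s c = 1) (hγ : ∀ t ∈ Icc a c, γ t = d.param (s t))
      (tail : Traverses γ c b w) : Traverses γ a b (d :: w)

/-- A graph map: a continuous map that sends vertices to vertices and every edge to an edge
path. -/
structure GraphMap (X Y : Type*) [TopologicalSpace X] [CWComplex (univ : Set X)]
    [TopologicalSpace Y] [CWComplex (univ : Set Y)] where
  toFun : X → Y
  continuous_toFun : Continuous toFun
  mapsTo_vertices : MapsTo toFun (vertices X) (vertices Y)
  /-- the edge path onto which an edge, with its given orientation, is mapped -/
  edgePath : Edge X → List (OrientedEdge Y)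
  traverses_edgePath : ∀ e : Edge X,
    Traverses (fun t => toFun (edgeMap e t)) (-1) 1 (edgePath e)

/-- An assignment of positive lengths to the edges of a graph, which makes it a metric graph. -/
structure EdgeLength (X : Type*) [TopologicalSpace X] [CWComplex (univ : Set X)] where
  length : Edge X → ℝ
  length_pos : ∀ e, 0 < length e

/-- The length of an edge path: the sum of the lengths of its edges, with multiplicity. -/
def EdgeLength.pathLength {X : Type*} [TopologicalSpace X] [CWComplex (univ : Set X)]
    (ℓ : EdgeLength X) (w : List (OrientedEdge X)) : ℝ :=
  (w.map fun d => ℓ.length d.1).sum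

/-- A graph map `f` of a metric graph to itself is uniformly `lam`-expanding if
`ℓ (f e) = lam * ℓ e` for every edge `e`. -/
def GraphMap.IsUniformlyExpanding {X : Type*} [TopologicalSpace X] [CWComplex (univ : Set X)]
    (f : GraphMap X X) (ℓ : EdgeLength X) (lam : ℝ) : Prop :=
  ∀ e : Edge X, ℓ.pathLength (f.edgePath e) = lam * ℓ.length e

end MetricGraphEntropy

end

/-!
The entropy of a uniformly `lam`-expanding graph map `f` is `log lam` because the image of an edge
`e` under `f^n` is an edge path of length `lam ^ n * ℓ e`, and the number of orbit segments of
length `n` that can be told apart grows like the number of edges in these paths. A shortest edge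
cannot be mapped to a shorter path, so `1 ≤ lam`
(`GraphMap.IsUniformlyExpanding.one_le`); no arithmetic property of `lam` plays a role.

*Upper bound.* Fix an entourage `V`. A monotone code (`IsCoded`) of a curve is a monotone labelling
of its parameter interval by `N` integers such that equal labels mean `V`-close values. Codes of
the edges are concatenated along edge paths, so the curve `f^j ∘ e` has a code with
`O (lam ^ j * ℓ e)` symbols. The sum of the codes of `f^j ∘ e` over `j < n` is again monotone and,
by monotonicity, determines all of its summands. Hence it is a code of `e` for the dynamical
entourage, with `O (n * lam ^ n)` symbols as `1 ≤ lam`, and each symbol costs one dynamical ball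
(`GraphMap.IsUniformlyExpanding.coverMincard_le`).

*Lower bound.* For fixed `m`, the parameter interval of each edge `e` contains disjoint intervals,
called laps, on each of which `f^m ∘ e` runs over a whole open edge, and the lengths of these edges
add up to `lam ^ m * ℓ e` (`GraphMap.IsUniformlyExpanding.exists_laps_iterate`). Neighbouring laps
may touch, so that orbits in them need not separate. If the leftmost and the rightmost lap are
dropped, however, the other ones stay in a compact part `K e` of the open edge, and each of them
contains a compact piece which `f^m` maps onto the part `K d` of the edge `d` below it. These
compact pieces are pairwise disjoint, hence a positive distance apart: they form a horseshoe for
`f^m`, with at least `const * (lam ^ m - C) ^ k` separated orbits of length `k`, where `C` does not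
depend on `m` (`exists_separated_of_horseshoe`). Thus `m * h(f) ≥ log (lam ^ m - C)`, and letting
`m` tend to infinity gives `h(f) ≥ log lam`.
-/

namespace MetricGraphEntropy

/-! ### Cells of a finite graph -/

section Cells

variable {X : Type*} [TopologicalSpace X] [CWComplex (univ : Set X)]

lemma const_mem_closedBall {t : ℝ} (ht : t ∈ Icc (-1 : ℝ) 1) :
    (fun _ : Fin 1 => t) ∈ Metric.closedBall (0 : Fin 1 → ℝ) 1 := by
  rw [mem_closedBall_zero_iff, pi_norm_le_iff_of_nonneg zero_le_one]
  intro _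
  rw [Real.norm_eq_abs]
  exact abs_le.2 ht

lemma continuousOn_edgeMap (e : Edge X) : ContinuousOn (edgeMap e) (Icc (-1) 1) :=
  (RelCWComplex.continuousOn (C := (univ : Set X)) 1 e).comp
    (continuous_pi fun _ => continuous_id).continuousOn fun _ => const_mem_closedBall

lemma injOn_edgeMap (e : Edge X) : InjOn (edgeMap e) (Ioo (-1) 1) := by
  have h : ∀ t ∈ Ioo (-1 : ℝ) 1,
      (fun _ : Fin 1 => t) ∈ (RelCWComplex.map (C := (univ : Set X)) 1 e).source := by
    intro t ht
    rw [RelCWComplex.source_eq, mem_ball_zero_iff, pi_norm_lt_iff zero_lt_one]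
    intro _
    rw [Real.norm_eq_abs]
    exact abs_lt.2 ht
  intro x hx y hy hxy
  exact congrFun ((RelCWComplex.map (C := (univ : Set X)) 1 e).injOn (h x hx) (h y hy) hxy) 0

lemma mem_vertices_or_mem_edge [IsFiniteGraph X] (x : X) :
    x ∈ vertices X ∨ ∃ e : Edge X, ∃ t ∈ Icc (-1 : ℝ) 1, edgeMap e t = x := by
  have hx : x ∈ ⋃ (n : ℕ) (j : RelCWComplex.cell (univ : Set X) n),
      RelCWComplex.closedCell n j := by
    rw [CWComplex.union]
    exact mem_univ x
  simp only [mem_iUnion] at hx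
  obtain ⟨n, j, hj⟩ := hx
  match n, j, hj with
  | 0, j, hj => exact Or.inl (mem_iUnion.2 ⟨j, hj⟩)
  | 1, j, hj =>
    obtain ⟨y, hy, rfl⟩ := hj
    refine Or.inr ⟨j, y 0, ?_, ?_⟩
    · rw [mem_closedBall_zero_iff, pi_norm_le_iff_of_nonneg zero_le_one] at hy
      exact abs_le.1 (hy 0)
    · have : (fun _ : Fin 1 => y 0) = y := by
        funext i
        rw [Subsingleton.elim i 0]
      simp only [edgeMap, this]
  | n + 2, j, _ => exact ((IsFiniteGraph.isEmpty_cell (X := X) (n + 2) (by omega)).false j).elim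

lemma finite_cell [IsFiniteGraph X] (n : ℕ) : Finite (RelCWComplex.cell (univ : Set X) n) := by
  have := RelCWComplex.finite_cells_of_finite (C := (univ : Set X))
    (finite := IsFiniteGraph.finite)
  exact Finite.of_injective (fun j => (⟨n, j⟩ : Σ n, RelCWComplex.cell (univ : Set X) n))
    sigma_mk_injective

lemma finite_vertices [IsFiniteGraph X] : (vertices X).Finite := by
  have := finite_cell (X := X) 0
  refine finite_iUnion fun v => ?_
  rw [RelCWComplex.closedCell_zero_eq_singleton]
  exact finite_singleton _

end Cells

/-! ### Monotone codes of curves -/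

section Codes

variable {X Y : Type*}

/-- The curve `γ` on `[a, b]` has a monotone code with `N` symbols: a monotone labelling of `[a, b]`
by `0, …, N - 1` such that points with the same label are sent to `V`-close points. -/
def IsCoded (V : SetRel Y Y) (a b : ℝ) (γ : ℝ → Y) (N : ℕ) : Prop :=
  ∃ G : ℝ → ℕ, MonotoneOn G (Icc a b) ∧ (∀ t ∈ Icc a b, G t < N) ∧
    ∀ x ∈ Icc a b, ∀ y ∈ Icc a b, G x = G y → (γ x, γ y) ∈ V

lemma IsCoded.congr {V : SetRel Y Y} {a b : ℝ} {γ γ' : ℝ → Y} {N : ℕ} (h : IsCoded V a b γ N)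
    (hγ : ∀ t ∈ Icc a b, γ' t = γ t) : IsCoded V a b γ' N := by
  obtain ⟨G, hG, hN, hV⟩ := h
  refine ⟨G, hG, hN, fun x hx y hy hxy => ?_⟩
  rw [hγ x hx, hγ y hy]
  exact hV x hx y hy hxy

lemma IsCoded.comp_monotone {V : SetRel Y Y} {a b a' b' : ℝ} {γ : ℝ → Y} {N : ℕ}
    (h : IsCoded V a b γ N) {s : ℝ → ℝ} (hs : MonotoneOn s (Icc a' b'))
    (hm : MapsTo s (Icc a' b') (Icc a b)) : IsCoded V a' b' (γ ∘ s) N := by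
  obtain ⟨G, hG, hN, hV⟩ := h
  exact ⟨G ∘ s, fun x hx y hy hxy => hG (hm hx) (hm hy) (hs hx hy hxy), fun t ht => hN _ (hm ht),
    fun x hx y hy hxy => hV _ (hm hx) _ (hm hy) hxy⟩

lemma IsCoded.comp_neg {V : SetRel Y Y} {γ : ℝ → Y} {N : ℕ} (h : IsCoded V (-1) 1 γ N) :
    IsCoded V (-1) 1 (fun t => γ (-t)) N := by
  obtain ⟨G, hG, hN, hV⟩ := h
  have hm : ∀ t ∈ Icc (-1 : ℝ) 1, -t ∈ Icc (-1 : ℝ) 1 := fun t ht =>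
    ⟨by linarith [ht.2], by linarith [ht.1]⟩
  refine ⟨fun t => N - 1 - G (-t), fun x hx y hy hxy => ?_, fun t ht => ?_, fun x hx y hy hxy => ?_⟩
  · have := hG (hm y hy) (hm x hx) (neg_le_neg hxy)
    dsimp only
    omega
  · have := hN _ (hm t ht)
    dsimp only
    omega
  · have h1 := hN _ (hm x hx)
    have h2 := hN _ (hm y hy)
    dsimp only at hxy
    exact hV _ (hm x hx) _ (hm y hy) (by omega)

lemma IsCoded.append {V : SetRel Y Y} {a b c : ℝ} {γ : ℝ → Y} {N N' : ℕ}
    (h : IsCoded V a c γ N) (h' : IsCoded V c b γ N') : IsCoded V a b γ (N + N') := by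
  obtain ⟨G, hG, hN, hV⟩ := h
  obtain ⟨G', hG', hN', hV'⟩ := h'
  classical
  refine ⟨fun t => if t ≤ c then G t else N + G' t, fun x hx y hy hxy => ?_, fun t ht => ?_,
    fun x hx y hy hxy => ?_⟩
  · dsimp only
    split_ifs with h1 h2 h2
    · exact hG ⟨hx.1, h1⟩ ⟨hy.1, h2⟩ hxy
    · have := hN x ⟨hx.1, h1⟩
      omega
    · exact absurd (hxy.trans h2) h1
    · exact Nat.add_le_add_left (hG' ⟨(not_le.1 h1).le, hx.2⟩ ⟨(not_le.1 h2).le, hy.2⟩ hxy) _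
  · dsimp only
    split_ifs with h1
    · exact (hN t ⟨ht.1, h1⟩).trans_le (Nat.le_add_right _ _)
    · exact Nat.add_lt_add_left (hN' t ⟨(not_le.1 h1).le, ht.2⟩) _
  · dsimp only at hxy
    split_ifs at hxy with h1 h2 h2
    · exact hV x ⟨hx.1, h1⟩ y ⟨hy.1, h2⟩ hxy
    · have := hN x ⟨hx.1, h1⟩
      omega
    · have := hN y ⟨hy.1, h2⟩
      omega
    · exact hV' x ⟨(not_le.1 h1).le, hx.2⟩ y ⟨(not_le.1 h2).le, hy.2⟩ (by omega)

lemma IsCoded.append_const {V : SetRel Y Y} {a b c : ℝ} {γ : ℝ → Y} {N : ℕ} (hac : a ≤ c)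
    (h : IsCoded V a c γ N) (hγ : ∀ t ∈ Icc c b, γ t = γ c) : IsCoded V a b γ N := by
  refine (h.comp_monotone (s := fun t => min t c) (a' := a) (b' := b)
    (fun x _ y _ hxy => min_le_min_right c hxy)
    fun t ht => ⟨le_min ht.1 hac, min_le_right _ _⟩).congr fun t ht => ?_
  rcases le_total t c with htc | htc
  · simp [htc]
  · simp [htc, hγ t ⟨htc, ht.2⟩]

/-- The sum of two monotone codes is a monotone code which determines both of them. -/
lemma IsCoded.prod {V V' : SetRel Y Y} {a b : ℝ} {γ γ' : ℝ → Y} {N N' : ℕ}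
    {W : SetRel X X} {δ : ℝ → X} (h : IsCoded V a b γ N) (h' : IsCoded V' a b γ' N')
    (hW : ∀ x y, (γ x, γ y) ∈ V → (γ' x, γ' y) ∈ V' → (δ x, δ y) ∈ W) :
    IsCoded W a b δ (N + N') := by
  obtain ⟨G, hG, hN, hV⟩ := h
  obtain ⟨G', hG', hN', hV'⟩ := h'
  refine ⟨fun t => G t + G' t, fun x hx y hy hxy => add_le_add (hG hx hy hxy) (hG' hx hy hxy),
    fun t ht => add_lt_add (hN t ht) (hN' t ht), fun x hx y hy hxy => ?_⟩
  -- By monotonicity, `G` and `G'` change in the same direction from `x` to `y`.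
  have key : G x = G y ∧ G' x = G' y := by
    dsimp only at hxy
    rcases le_total x y with hle | hle
    · have h1 := hG hx hy hle
      have h2 := hG' hx hy hle
      omega
    · have h1 := hG hy hx hle
      have h2 := hG' hy hx hle
      omega
  exact hW x y (hV x hx y hy key.1) (hV' x hx y hy key.2)

/-- A coded curve is covered by as many balls as there are symbols. -/
lemma IsCoded.exists_isCover {V : SetRel Y Y} {a b : ℝ} {γ : ℝ → Y} {N : ℕ}
    (h : IsCoded V a b γ N) :
    ∃ s : Finset Y, s.card ≤ N ∧ ∀ t ∈ Icc a b, ∃ y ∈ s, (γ t, y) ∈ V := by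
  obtain ⟨G, -, hN, hV⟩ := h
  classical
  have hr : ∀ n : ℕ, ∃ y : ℝ, (∃ t ∈ Icc a b, G t = n) → y ∈ Icc a b ∧ G y = n := by
    intro n
    by_cases hn : ∃ t ∈ Icc a b, G t = n
    · obtain ⟨t, ht⟩ := hn
      exact ⟨t, fun _ => ht⟩
    · exact ⟨0, fun h => absurd h hn⟩
  choose r hr using hr
  refine ⟨(Finset.range N).image (γ ∘ r), Finset.card_image_le.trans (Finset.card_range N).le,
    fun t ht => ?_⟩
  obtain ⟨h1, h2⟩ := hr (G t) ⟨t, ht, rfl⟩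
  exact ⟨γ (r (G t)), Finset.mem_image_of_mem _ (Finset.mem_range.2 (hN t ht)),
    hV t ht _ h1 h2.symm⟩

/-- By uniform continuity, a continuous curve is coded at every scale. -/
lemma exists_isCoded_of_continuousOn [PseudoMetricSpace Y] {γ : ℝ → Y} {a b : ℝ}
    (hγ : ContinuousOn γ (Icc a b)) {V : SetRel Y Y} (hV : V ∈ uniformity Y) :
    ∃ N, IsCoded V a b γ N := by
  obtain ⟨ε, hε, hεV⟩ := Metric.mem_uniformity_dist.1 hV
  have huc := isCompact_Icc.uniformContinuousOn_of_continuous hγ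
  obtain ⟨δ, hδ, h⟩ := Metric.uniformContinuousOn_iff.1 huc ε hε
  refine ⟨⌊(b - a) / δ⌋₊ + 1, fun t => ⌊(t - a) / δ⌋₊, fun x _ y _ hxy => ?_, fun t ht => ?_,
    fun x hx y hy hxy => hεV (h x hx y hy ?_)⟩
  · exact Nat.floor_mono (by gcongr)
  · exact Nat.lt_succ_of_le (Nat.floor_mono (by have := ht.2; gcongr))
  · have hx0 : 0 ≤ (x - a) / δ := div_nonneg (sub_nonneg.2 hx.1) hδ.le
    have hy0 : 0 ≤ (y - a) / δ := div_nonneg (sub_nonneg.2 hy.1) hδ.le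
    have h1 := Nat.floor_le hx0
    have h2 := Nat.lt_floor_add_one ((x - a) / δ)
    have h3 := Nat.floor_le hy0
    have h4 := Nat.lt_floor_add_one ((y - a) / δ)
    dsimp only at hxy
    rw [hxy] at h1 h2
    have h5 : |(x - a) / δ - (y - a) / δ| < 1 := abs_lt.2 ⟨by linarith, by linarith⟩
    rwa [← sub_div, abs_div, abs_of_pos hδ, div_lt_one hδ, sub_sub_sub_cancel_right] at h5

end Codes

/-! ### Codes along edge paths -/

section Traverses

variable {X Y : Type*} [TopologicalSpace X] [CWComplex (univ : Set X)]

lemma mapsTo_of_monotoneOn_Icc {s : ℝ → ℝ} {a c : ℝ} (hac : a < c) (hs : MonotoneOn s (Icc a c))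
    (ha : s a = -1) (hc : s c = 1) : MapsTo s (Icc a c) (Icc (-1) 1) := fun _ ht =>
  ⟨ha ▸ hs (left_mem_Icc.2 hac.le) ht ht.1, hc ▸ hs ht (right_mem_Icc.2 hac.le) ht.2⟩

lemma Traverses.isCoded_comp {V : SetRel Y Y} {F : X → Y} {N : Edge X → ℕ}
    (hN : ∀ e, IsCoded V (-1) 1 (fun t => F (edgeMap e t)) (N e)) {γ : ℝ → X} {a b : ℝ}
    {w : List (OrientedEdge X)} (h : Traverses γ a b w) (hw : w ≠ []) :
    IsCoded V a b (fun t => F (γ t)) (w.map fun d => N d.1).sum := by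
  induction h with
  | nil => exact absurd rfl hw
  | @cons a b c d w s hac s_mono s_cont s_left s_right hγ tail ih =>
    have hd : IsCoded V (-1) 1 (fun t => F (d.param t)) (N d.1) := by
      obtain ⟨e, o⟩ := d
      cases o
      · exact (hN e).comp_neg
      · exact hN e
    have hfirst : IsCoded V a c (fun t => F (γ t)) (N d.1) :=
      (hd.comp_monotone s_mono (mapsTo_of_monotoneOn_Icc hac s_mono s_left s_right)).congr
        fun t ht => congrArg F (hγ t ht)
    rw [List.map_cons, List.sum_cons]
    by_cases hw' : w = []
    -- An empty tail is a constant curve, which must not cost an extra symbol: otherwise the number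
    -- of symbols would not be multiplied exactly by `lam` under each iteration.
    · subst hw'
      cases tail with
      | nil hcb hv hconst =>
        refine hfirst.append_const hac.le fun t ht => ?_
        rw [hconst t ht, hconst c (left_mem_Icc.2 hcb)]
    · exact hfirst.append (ih hw')

end Traverses

/-! ### Uniformly expanding maps -/

section Expanding

variable {X : Type*} [TopologicalSpace X] [CWComplex (univ : Set X)]
  {ℓ : EdgeLength X} {f : GraphMap X X} {lam : ℝ}

lemma GraphMap.IsUniformlyExpanding.edgePath_ne_nil (hf : f.IsUniformlyExpanding ℓ lam)
    (hlam : 0 < lam) (e : Edge X) : f.edgePath e ≠ [] := by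
  intro h
  have h1 := hf e
  rw [h] at h1
  have h2 := mul_pos hlam (ℓ.length_pos e)
  rw [← h1] at h2
  simp [EdgeLength.pathLength] at h2

/-- The image of a shortest edge contains at least one edge, which is not shorter. -/
lemma GraphMap.IsUniformlyExpanding.one_le [IsFiniteGraph X] [Nonempty (Edge X)]
    (hf : f.IsUniformlyExpanding ℓ lam) (hlam : 0 < lam) : 1 ≤ lam := by
  have := finite_cell (X := X) 1
  obtain ⟨e, he⟩ := Finite.exists_min ℓ.length
  obtain ⟨d, w, hw⟩ := List.exists_cons_of_ne_nil (hf.edgePath_ne_nil hlam e)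
  have h1 := hf e
  rw [hw, EdgeLength.pathLength, List.map_cons, List.sum_cons] at h1
  have h2 : 0 ≤ (w.map fun d => ℓ.length d.1).sum :=
    List.sum_nonneg fun x hx => by
      obtain ⟨d, -, rfl⟩ := List.mem_map.1 hx
      exact (ℓ.length_pos _).le
  have h3 := he d.1
  have h4 := ℓ.length_pos e
  by_contra hlt
  nlinarith

end Expanding

/-! ### The upper bound -/

section UpperBound

variable {X : Type*} [MetricSpace X] [CWComplex (univ : Set X)]
  {ℓ : EdgeLength X} {f : GraphMap X X} {lam : ℝ}

/-- The iterates of an edge have codes whose number of symbols grows like the length of the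
image. -/
lemma GraphMap.IsUniformlyExpanding.exists_isCoded_iterate [IsFiniteGraph X]
    (hf : f.IsUniformlyExpanding ℓ lam) (hlam : 0 < lam) {V : SetRel X X}
    (hV : V ∈ uniformity X) :
    ∃ C : ℝ, 0 ≤ C ∧ ∀ n : ℕ, ∃ N : Edge X → ℕ,
      (∀ e, IsCoded V (-1) 1 (fun t => f.toFun^[n] (edgeMap e t)) (N e)) ∧
      ∀ e, (N e : ℝ) ≤ C * lam ^ n * ℓ.length e := by
  have := finite_cell (X := X) 1
  choose M hM using fun e : Edge X => exists_isCoded_of_continuousOn (continuousOn_edgeMap e) hV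
  obtain ⟨C, hC⟩ := (finite_range fun e : Edge X => (M e : ℝ) / ℓ.length e).bddAbove
  refine ⟨max C 0, le_max_right _ _, fun n => ?_⟩
  induction n with
  | zero =>
    refine ⟨M, hM, fun e => ?_⟩
    have h1 : (M e : ℝ) / ℓ.length e ≤ max C 0 := (hC (mem_range_self e)).trans (le_max_left _ _)
    rw [pow_zero, mul_one]
    exact (div_le_iff₀ (ℓ.length_pos e)).1 h1
  | succ n ih =>
    obtain ⟨N, hN, hb⟩ := ih
    refine ⟨fun e => ((f.edgePath e).map fun d => N d.1).sum, fun e => ?_, fun e => ?_⟩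
    · exact (f.traverses_edgePath e).isCoded_comp hN (hf.edgePath_ne_nil hlam e)
    · have key : ∀ w : List (OrientedEdge X),
          ((w.map fun d => N d.1).sum : ℝ) ≤ max C 0 * lam ^ n * ℓ.pathLength w := by
        intro w
        induction w with
        | nil => simp [EdgeLength.pathLength]
        | cons d w ih =>
          have := hb d.1
          simp only [EdgeLength.pathLength, List.map_cons, List.sum_cons, Nat.cast_add] at ih ⊢
          linarith
      refine (key _).trans_eq ?_
      rw [hf e]
      ring

/-- The number of dynamical balls needed to cover the graph up to time `n` is at most
`D * (n + 1) * lam ^ n`. -/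
lemma GraphMap.IsUniformlyExpanding.coverMincard_le [IsFiniteGraph X] [Nonempty (Edge X)]
    (hf : f.IsUniformlyExpanding ℓ lam) (hlam : 0 < lam) {V : SetRel X X} [V.IsRefl]
    (hV : V ∈ uniformity X) :
    ∃ D : ℝ, ∀ n : ℕ, ∃ k : ℕ, Dynamics.coverMincard f.toFun univ V n ≤ k ∧
      (k : ℝ) ≤ D * ((n + 1) * lam ^ n) := by
  classical
  have := finite_cell (X := X) 1
  have := Fintype.ofFinite (Edge X)
  have h1 := hf.one_le hlam
  obtain ⟨C, hC0, hC⟩ := hf.exists_isCoded_iterate hlam hV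
  choose N hN hNC using hC
  have hcode : ∀ e : Edge X, ∀ n : ℕ, IsCoded (Dynamics.dynEntourage f.toFun V n) (-1) 1
      (edgeMap e) (1 + ∑ j ∈ Finset.range n, N j e) := by
    intro e n
    induction n with
    | zero =>
      refine ⟨fun _ => 0, fun _ _ _ _ _ => le_rfl, fun _ _ => by simp, fun x _ y _ _ => ?_⟩
      simp
    | succ n ih =>
      rw [Finset.sum_range_succ, ← add_assoc]
      refine ih.prod (hN n e) fun x y hx hy => ?_
      rw [Dynamics.mem_dynEntourage] at hx ⊢
      intro k hk
      rcases Nat.lt_succ_iff_lt_or_eq.1 hk with hk | rfl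
      · exact hx k hk
      · exact hy
  let L := ∑ e : Edge X, ℓ.length e
  refine ⟨(finite_vertices (X := X)).toFinset.card + Fintype.card (Edge X) + C * L, fun n => ?_⟩
  choose s hs hcov using fun e => (hcode e n).exists_isCover
  refine ⟨_, Dynamics.IsDynCoverOf.coverMincard_le_card
    (s := (finite_vertices (X := X)).toFinset ∪ Finset.univ.biUnion s) ?_, ?_⟩
  · intro x _
    rcases mem_vertices_or_mem_edge x with hx | ⟨e, t, ht, rfl⟩
    · refine ⟨x, by simp [hx], ?_⟩
      exact SetRel.rfl _
    · obtain ⟨y, hy, hxy⟩ := hcov e t ht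
      exact ⟨y, by simpa using Or.inr ⟨e, hy⟩, hxy⟩
  · have hp : ∀ j ≤ n, lam ^ j ≤ lam ^ n := fun j hj => pow_le_pow_right₀ h1 hj
    have hcard : ∀ e, ((s e).card : ℝ) ≤ 1 + n * (C * lam ^ n * ℓ.length e) := by
      intro e
      calc ((s e).card : ℝ) ≤ ((1 + ∑ j ∈ Finset.range n, N j e : ℕ) : ℝ) := by
            exact_mod_cast hs e
        _ = 1 + ∑ j ∈ Finset.range n, (N j e : ℝ) := by push_cast; rfl
        _ ≤ 1 + ∑ j ∈ Finset.range n, C * lam ^ n * ℓ.length e := by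
            gcongr with j hj
            refine (hNC j e).trans ?_
            have := (ℓ.length_pos e).le
            have := hp j (Finset.mem_range.1 hj).le
            gcongr
        _ = _ := by simp
    have hL : 0 ≤ L := Finset.sum_nonneg fun e _ => (ℓ.length_pos e).le
    have hpn : 1 ≤ lam ^ n := one_le_pow₀ h1
    have hQ : 1 ≤ ((n : ℝ) + 1) * lam ^ n := by
      have : (0 : ℝ) ≤ n := n.cast_nonneg
      nlinarith
    calc (((finite_vertices (X := X)).toFinset ∪ Finset.univ.biUnion s).card : ℝ)
        ≤ (((finite_vertices (X := X)).toFinset.card + ∑ e, (s e).card : ℕ) : ℝ) := by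
          exact_mod_cast (Finset.card_union_le _ _).trans
            (Nat.add_le_add_left Finset.card_biUnion_le _)
      _ = (finite_vertices (X := X)).toFinset.card + ∑ e, ((s e).card : ℝ) := by push_cast; rfl
      _ ≤ (finite_vertices (X := X)).toFinset.card
            + ∑ e : Edge X, (1 + n * (C * lam ^ n * ℓ.length e)) := by
          gcongr with e
          exact hcard e
      _ = (finite_vertices (X := X)).toFinset.card + Fintype.card (Edge X)
            + C * L * (n * lam ^ n) := by
          rw [Finset.sum_add_distrib, ← Finset.mul_sum, ← Finset.mul_sum]
          simp only [Finset.sum_const, Finset.card_univ, nsmul_eq_mul, mul_one]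
          ring
      _ ≤ ((finite_vertices (X := X)).toFinset.card + Fintype.card (Edge X))
            * ((n + 1) * lam ^ n) + C * L * ((n + 1) * lam ^ n) := by
          gcongr
          · exact le_mul_of_one_le_right (by positivity) hQ
          · linarith
      _ = _ := by ring

lemma expGrowthSup_le_log_of_le {u : ℕ → ENNReal} {lam D : ℝ} (hlam : 0 < lam)
    (hu : ∀ n : ℕ, u n ≤ ENNReal.ofReal (D * ((n + 1) * lam ^ n))) :
    ExpGrowth.expGrowthSup u ≤ ENNReal.log (ENNReal.ofReal lam) := by
  -- Any `μ > lam` absorbs the linear factor `n + 1`.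
  have key : ∀ μ : ℝ, lam < μ → ExpGrowth.expGrowthSup u ≤ ENNReal.log (ENNReal.ofReal μ) := by
    intro μ hμ
    have hμ0 : 0 < μ := hlam.trans hμ
    have hr : |lam / μ| < 1 := by
      rw [abs_of_pos (by positivity), div_lt_one hμ0]
      exact hμ
    have h0 : Filter.Tendsto (fun n : ℕ => (n : ℝ) * (lam / μ) ^ n + (lam / μ) ^ n) Filter.atTop
        (𝓝 (0 + 0)) :=
      (tendsto_self_mul_const_pow_of_abs_lt_one hr).add (tendsto_pow_atTop_nhds_zero_of_abs_lt_one hr)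
    obtain ⟨B, hB⟩ := h0.bddAbove_range
    rw [← ExpGrowth.expGrowthSup_pow]
    refine ExpGrowth.expGrowthSup_le_of_eventually_le (b := ENNReal.ofReal (|D| * B))
      ENNReal.ofReal_ne_top (Filter.Eventually.of_forall fun n => (hu n).trans ?_)
    rw [← ENNReal.ofReal_pow hμ0.le, ← ENNReal.ofReal_mul' (by positivity)]
    refine ENNReal.ofReal_le_ofReal ?_
    have hBn : (n : ℝ) * (lam / μ) ^ n + (lam / μ) ^ n ≤ B := hB (mem_range_self n)
    have h2 : ((n : ℝ) + 1) * lam ^ n ≤ B * μ ^ n := by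
      have h3 : ((n : ℝ) + 1) * lam ^ n = ((n : ℝ) * (lam / μ) ^ n + (lam / μ) ^ n) * μ ^ n := by
        rw [div_pow]
        field_simp
      rw [h3]
      gcongr
    calc D * (((n : ℝ) + 1) * lam ^ n) ≤ |D| * (((n : ℝ) + 1) * lam ^ n) := by
          gcongr
          exact le_abs_self D
      _ ≤ |D| * (B * μ ^ n) := by gcongr
      _ = |D| * B * μ ^ n := by ring
  have hlim : Filter.Tendsto (fun μ : ℝ => ENNReal.log (ENNReal.ofReal μ)) (𝓝[>] lam)
      (𝓝 (ENNReal.log (ENNReal.ofReal lam))) :=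
    ((ENNReal.continuous_log.comp ENNReal.continuous_ofReal).tendsto lam).mono_left
      nhdsWithin_le_nhds
  exact ge_of_tendsto hlim (eventually_mem_nhdsWithin.mono key)

lemma GraphMap.IsUniformlyExpanding.coverEntropy_le [IsFiniteGraph X] [Nonempty (Edge X)]
    (hf : f.IsUniformlyExpanding ℓ lam) (hlam : 0 < lam) :
    Dynamics.coverEntropy f.toFun (univ : Set X) ≤ ENNReal.log (ENNReal.ofReal lam) := by
  refine iSup₂_le fun V hV => ?_
  have : SetRel.IsRefl V := isRefl_of_mem_uniformity hV
  obtain ⟨D, hD⟩ := hf.coverMincard_le hlam hV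
  refine expGrowthSup_le_log_of_le (D := D) hlam fun n => ?_
  obtain ⟨k, hk, hkD⟩ := hD n
  calc ((Dynamics.coverMincard f.toFun univ V n : ℕ∞) : ENNReal) ≤ ((k : ℕ∞) : ENNReal) := by
        exact_mod_cast hk
    _ = ENNReal.ofReal k := by simp
    _ ≤ _ := ENNReal.ofReal_le_ofReal hkD

end UpperBound

/-! ### Laps of a curve -/

section Laps

variable {X : Type*} [TopologicalSpace X] [CWComplex (univ : Set X)]

/-- A finite family of laps of the curve `γ` inside `(a, b)`: pairwise disjoint intervals on each of
which `γ` follows an open edge, by means of a continuous coordinate which takes all values in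
`(-1, 1)`. The laps need not fill `(a, b)`, and the coordinates need not be monotone. -/
structure Laps (γ : ℝ → X) (a b : ℝ) where
  /-- the index set of the family -/
  ι : Type
  [fintype_ι : Fintype ι]
  /-- the intervals on which the laps take place -/
  dom : ι → Set ℝ
  /-- the edge along which a lap runs -/
  edge : ι → Edge X
  /-- the position along the edge, as a parameter in `[-1, 1]` -/
  coord : ι → ℝ → ℝ
  dom_subset : ∀ i, dom i ⊆ Ioo a b
  ordConnected : ∀ i, (dom i).OrdConnected
  disjoint : ∀ i j, i ≠ j → Disjoint (dom i) (dom j)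
  continuousOn : ∀ i, ContinuousOn (coord i) (dom i)
  surjOn : ∀ i, SurjOn (coord i) (dom i) (Ioo (-1) 1)
  eq_edgeMap : ∀ i, ∀ t ∈ dom i, γ t = edgeMap (edge i) (coord i t)

namespace Laps

attribute [instance] Laps.fintype_ι

/-- The sum of the lengths of the edges along which the laps run. -/
def totalLength {γ : ℝ → X} {a b : ℝ} (P : Laps γ a b) (ℓ : EdgeLength X) : ℝ :=
  ∑ i, ℓ.length (P.edge i)

/-- The family without laps. -/
def empty (γ : ℝ → X) (a b : ℝ) : Laps γ a b where
  ι := Empty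
  dom := nofun
  edge := nofun
  coord := nofun
  dom_subset := nofun
  ordConnected := nofun
  disjoint := nofun
  continuousOn := nofun
  surjOn := nofun
  eq_edgeMap := nofun

/-- An edge is a lap of itself. -/
def ofEdge (e : Edge X) : Laps (edgeMap e) (-1) 1 where
  ι := Unit
  dom _ := Ioo (-1) 1
  edge _ := e
  coord _ := id
  dom_subset _ := Subset.rfl
  ordConnected _ := ordConnected_Ioo
  disjoint i j h := absurd (Subsingleton.elim i j) h
  continuousOn _ := continuousOn_id
  surjOn _ := surjOn_id _
  eq_edgeMap _ _ _ := rfl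

/-- The same laps for a curve with the same values. -/
def congr {γ γ' : ℝ → X} {a b : ℝ} (P : Laps γ a b) (h : ∀ t ∈ Icc a b, γ' t = γ t) :
    Laps γ' a b where
  __ := P
  eq_edgeMap i t ht := (h t (Ioo_subset_Icc_self (P.dom_subset i ht))).trans (P.eq_edgeMap i t ht)

/-- The laps of a curve on two consecutive intervals, taken together. -/
def append {γ : ℝ → X} {a b c : ℝ} (hac : a ≤ c) (hcb : c ≤ b) (P : Laps γ a c) (Q : Laps γ c b) :
    Laps γ a b where
  ι := P.ι ⊕ Q.ι
  dom := Sum.elim P.dom Q.dom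
  edge := Sum.elim P.edge Q.edge
  coord := Sum.elim P.coord Q.coord
  dom_subset := by
    rintro (i | i)
    · exact (P.dom_subset i).trans (Ioo_subset_Ioo_right hcb)
    · exact (Q.dom_subset i).trans (Ioo_subset_Ioo_left hac)
  ordConnected := by
    rintro (i | i)
    · exact P.ordConnected i
    · exact Q.ordConnected i
  disjoint := by
    have h : ∀ i j, Disjoint (P.dom i) (Q.dom j) := fun i j =>
      disjoint_left.2 fun t h1 h2 => (P.dom_subset i h1).2.not_gt (Q.dom_subset j h2).1
    rintro (i | i) (j | j) hij
    · exact P.disjoint i j fun h => hij (congrArg _ h)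
    · exact h i j
    · exact (h j i).symm
    · exact Q.disjoint i j fun h => hij (congrArg _ h)
  continuousOn := by
    rintro (i | i)
    · exact P.continuousOn i
    · exact Q.continuousOn i
  surjOn := by
    rintro (i | i)
    · exact P.surjOn i
    · exact Q.surjOn i
  eq_edgeMap := by
    rintro (i | i)
    · exact P.eq_edgeMap i
    · exact Q.eq_edgeMap i

/-- The laps of a curve after a monotone change of parameter. -/
def compMonotone {γ : ℝ → X} {s : ℝ → ℝ} {a c : ℝ} (P : Laps γ (-1) 1) (hac : a < c)
    (s_mono : MonotoneOn s (Icc a c)) (s_cont : ContinuousOn s (Icc a c)) (s_left : s a = -1)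
    (s_right : s c = 1) : Laps (fun t => γ (s t)) a c where
  ι := P.ι
  dom i := {t ∈ Ioo a c | s t ∈ P.dom i}
  edge := P.edge
  coord i t := P.coord i (s t)
  dom_subset _ _ ht := ht.1
  ordConnected i := by
    refine ⟨fun x hx y hy t ht => ?_⟩
    have htac : t ∈ Ioo a c := ⟨hx.1.1.trans_le ht.1, ht.2.trans_lt hy.1.2⟩
    exact ⟨htac, (P.ordConnected i).out hx.2 hy.2
      ⟨s_mono (Ioo_subset_Icc_self hx.1) (Ioo_subset_Icc_self htac) ht.1,
        s_mono (Ioo_subset_Icc_self htac) (Ioo_subset_Icc_self hy.1) ht.2⟩⟩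
  disjoint i j hij := disjoint_left.2 fun t hi hj =>
    disjoint_left.1 (P.disjoint i j hij) hi.2 hj.2
  continuousOn i := (P.continuousOn i).comp
    (s_cont.mono fun _ ht => Ioo_subset_Icc_self ht.1) fun _ ht => ht.2
  surjOn i := by
    intro v hv
    obtain ⟨u, hu, rfl⟩ := P.surjOn i hv
    have hu1 := P.dom_subset i hu
    obtain ⟨t, ht, rfl⟩ := intermediate_value_Icc hac.le s_cont
      (show u ∈ Icc (s a) (s c) by rw [s_left, s_right]; exact Ioo_subset_Icc_self hu1)
    refine ⟨t, ⟨⟨lt_of_le_of_ne ht.1 ?_, lt_of_le_of_ne ht.2 ?_⟩, hu⟩, rfl⟩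
    · rintro rfl
      exact hu1.1.ne' s_left
    · rintro rfl
      exact hu1.2.ne s_right
  eq_edgeMap i _ ht := P.eq_edgeMap i _ ht.2

/-- The laps of a curve run backwards. -/
def compNeg {γ : ℝ → X} (P : Laps γ (-1) 1) : Laps (fun t => γ (-t)) (-1) 1 where
  ι := P.ι
  dom i := {t | -t ∈ P.dom i}
  edge := P.edge
  coord i t := P.coord i (-t)
  dom_subset i t ht := ⟨by linarith [(P.dom_subset i ht).2], by linarith [(P.dom_subset i ht).1]⟩
  ordConnected i := ⟨fun _ hx _ hy _ ht =>
    (P.ordConnected i).out hy hx ⟨neg_le_neg ht.2, neg_le_neg ht.1⟩⟩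
  disjoint i j hij := disjoint_left.2 fun _ hi hj => disjoint_left.1 (P.disjoint i j hij) hi hj
  continuousOn i := (P.continuousOn i).comp continuous_neg.continuousOn fun _ ht => ht
  surjOn i := by
    intro v hv
    obtain ⟨u, hu, rfl⟩ := P.surjOn i hv
    exact ⟨-u, by simpa using hu, by simp⟩
  eq_edgeMap i _ ht := P.eq_edgeMap i _ ht

/-- Each lap contains a compact set which still runs over a given compact part of the open edge. -/
lemma exists_isCompact {γ : ℝ → X} {a b p q : ℝ} (P : Laps γ a b) (i : P.ι) (hpq : p ≤ q)
    (h : Icc p q ⊆ Ioo (-1) 1) :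
    ∃ Q ⊆ P.dom i, IsCompact Q ∧ Icc p q ⊆ P.coord i '' Q := by
  obtain ⟨t₁, h₁, rfl⟩ := P.surjOn i (h (left_mem_Icc.2 hpq))
  obtain ⟨t₂, h₂, rfl⟩ := P.surjOn i (h (right_mem_Icc.2 hpq))
  have hsub := (P.ordConnected i).uIcc_subset h₁ h₂
  refine ⟨uIcc t₁ t₂, hsub, isCompact_uIcc, ?_⟩
  rw [← uIcc_of_le hpq]
  exact intermediate_value_uIcc ((P.continuousOn i).mono hsub)

/-- All laps but the leftmost and the rightmost one lie in a common compact subinterval. -/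
lemma exists_inner {γ : ℝ → X} {a b : ℝ} (P : Laps γ a b) {ℓ : EdgeLength X} {B : ℝ}
    (hB : ∀ e, ℓ.length e ≤ B) (hP : 0 < P.totalLength ℓ) :
    ∃ p q : ℝ, p ≤ q ∧ Icc p q ⊆ Ioo a b ∧ ∃ J : Finset P.ι, (∀ i ∈ J, P.dom i ⊆ Icc p q) ∧
      P.totalLength ℓ - 2 * B ≤ ∑ i ∈ J, ℓ.length (P.edge i) := by
  classical
  have hne : Nonempty P.ι := by
    by_contra h
    have := not_nonempty_iff.1 h
    simp [totalLength] at hP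
  have hr : ∀ i, ∃ r, r ∈ P.dom i := fun i => by
    obtain ⟨r, hr, -⟩ := P.surjOn i (show (0 : ℝ) ∈ Ioo (-1) 1 by norm_num)
    exact ⟨r, hr⟩
  choose r hr using hr
  obtain ⟨i₀, h₀⟩ := Finite.exists_min r
  obtain ⟨i₁, h₁⟩ := Finite.exists_max r
  refine ⟨r i₀, r i₁, h₀ i₁, fun t ht => ⟨(P.dom_subset _ (hr i₀)).1.trans_le ht.1,
    ht.2.trans_lt (P.dom_subset _ (hr i₁)).2⟩, Finset.univ \ {i₀, i₁}, fun i hi t ht => ?_, ?_⟩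
  · simp only [Finset.mem_sdiff, Finset.mem_univ, Finset.mem_insert, Finset.mem_singleton,
      true_and, not_or] at hi
    -- An interval disjoint from another one cannot have points on both sides of it.
    constructor
    · by_contra hlt
      exact disjoint_left.1 (P.disjoint i i₀ hi.1)
        ((P.ordConnected i).out ht (hr i) ⟨(not_le.1 hlt).le, h₀ i⟩) (hr i₀)
    · by_contra hlt
      exact disjoint_left.1 (P.disjoint i i₁ hi.2)
        ((P.ordConnected i).out (hr i) ht ⟨h₁ i, (not_le.1 hlt).le⟩) (hr i₁)
  · have hB0 : 0 ≤ B := (ℓ.length_pos (P.edge i₀)).le.trans (hB _)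
    have hsum := Finset.sum_sdiff (f := fun i => ℓ.length (P.edge i))
      (Finset.subset_univ ({i₀, i₁} : Finset P.ι))
    have h2 : ∑ i ∈ ({i₀, i₁} : Finset P.ι), ℓ.length (P.edge i) ≤ 2 * B := by
      refine (Finset.sum_le_card_nsmul _ _ B fun i _ => hB _).trans ?_
      rw [nsmul_eq_mul]
      gcongr
      exact_mod_cast Finset.card_le_two
    rw [totalLength]
    linarith

end Laps

lemma Traverses.le {γ : ℝ → X} {a b : ℝ} {w : List (OrientedEdge X)} (h : Traverses γ a b w) :
    a ≤ b := by
  induction h with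
  | nil hab => exact hab
  | cons s hac _ _ _ _ _ _ ih => exact hac.le.trans ih

lemma Traverses.exists_laps_comp {F : X → X} {ℓ : EdgeLength X} {L : Edge X → ℝ}
    (hL : ∀ e, ∃ P : Laps (fun t => F (edgeMap e t)) (-1) 1, P.totalLength ℓ = L e) {γ : ℝ → X}
    {a b : ℝ} {w : List (OrientedEdge X)} (h : Traverses γ a b w) :
    ∃ P : Laps (fun t => F (γ t)) a b, P.totalLength ℓ = (w.map fun d => L d.1).sum := by
  induction h with
  | nil => exact ⟨Laps.empty _ _ _, Fintype.sum_empty (ι := Empty) _⟩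
  | @cons a b c d w s hac s_mono s_cont s_left s_right hγ tail ih =>
    obtain ⟨Q, hQ⟩ := ih
    have hd : ∃ P : Laps (fun t => F (d.param t)) (-1) 1, P.totalLength ℓ = L d.1 := by
      obtain ⟨e, o⟩ := d
      obtain ⟨P, hP⟩ := hL e
      cases o
      · exact ⟨P.compNeg, hP⟩
      · exact ⟨P, hP⟩
    obtain ⟨P, hP⟩ := hd
    refine ⟨((P.compMonotone hac s_mono s_cont s_left s_right).congr
      fun t ht => congrArg F (hγ t ht)).append hac.le tail.le Q, ?_⟩
    rw [List.map_cons, List.sum_cons, ← hQ, ← hP]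
    exact Fintype.sum_sum_type _

/-- The `n`-th image of an edge has laps of total length `lam ^ n` times the length of the edge. -/
lemma GraphMap.IsUniformlyExpanding.exists_laps_iterate {ℓ : EdgeLength X} {f : GraphMap X X}
    {lam : ℝ} (hf : f.IsUniformlyExpanding ℓ lam) (n : ℕ) (e : Edge X) :
    ∃ P : Laps (fun t => f.toFun^[n] (edgeMap e t)) (-1) 1,
      P.totalLength ℓ = lam ^ n * ℓ.length e := by
  induction n generalizing e with
  | zero =>
    refine ⟨Laps.ofEdge e, ?_⟩
    rw [pow_zero, one_mul]
    exact Fintype.sum_unique (ι := Unit) _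
  | succ n ih =>
    obtain ⟨P, hP⟩ := (f.traverses_edgePath e).exists_laps_comp ih
    refine ⟨P, hP.trans ?_⟩
    rw [List.sum_map_mul_left, pow_succ, mul_assoc, ← hf e, EdgeLength.pathLength]

end Laps

/-! ### Horseshoes and separated orbits -/

section Horseshoe

/-- Finitely many pairwise disjoint compact sets are a positive distance apart. -/
lemma exists_mem_uniformity_separating {X ι : Type*} [UniformSpace X] [T2Space X] [Finite ι]
    {K : ι → Set X} (hK : ∀ i, IsCompact (K i)) (hd : ∀ i j, i ≠ j → Disjoint (K i) (K j)) :
    ∃ V ∈ uniformity X, ∀ i j, i ≠ j → ∀ x ∈ K i, ∀ y ∈ K j, (x, y) ∉ V := by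
  have h : ∀ i j, ∃ V ∈ uniformity X, i ≠ j → ∀ x ∈ K i, ∀ y ∈ K j, (x, y) ∉ V := by
    intro i j
    by_cases hij : i = j
    · exact ⟨univ, Filter.univ_mem, fun h => absurd hij h⟩
    · obtain ⟨V, hV, hdV⟩ := (hd i j hij).exists_uniform_thickening (hK i) (hK j).isClosed
      refine ⟨V, hV, fun _ x hx y hy hxy => disjoint_left.1 hdV (mem_iUnion₂.2 ⟨x, hx, hxy⟩)
        (mem_iUnion₂.2 ⟨y, hy, refl_mem_uniformity hV⟩)⟩
  choose V hV hVs using h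
  exact ⟨⋂ i, ⋂ j, V i j, Filter.iInter_mem.2 fun i => Filter.iInter_mem.2 fun j => hV i j,
    fun i j hij x hx y hy hxy => hVs i j hij x hx y hy (mem_iInter₂.1 hxy i j)⟩

/-- A horseshoe with several rectangles: the part `K e` of the curve `γ e` contains pairwise
separated pieces `Q e i`, and `g` maps the piece `Q e i` onto the part `K (d e i)` of the curve
`γ (d e i)`. If `L` is a positive weight which is expanded by the factor `μ`, then there are at
least constantly many times `μ ^ k` orbits of length `k` which are pairwise separated. -/
lemma exists_separated_of_horseshoe {X E : Type*} {g : X → X} {γ : E → ℝ → X} {K : E → Set ℝ}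
    {V : SetRel X X} [V.IsRefl] {ι : E → Type} {J : ∀ e, Finset (ι e)} {d : ∀ e, ι e → E}
    {c : ∀ e, ι e → ℝ → ℝ} {Q : ∀ e, ι e → Set ℝ} (hK : ∀ e, (K e).Nonempty)
    (hQ : ∀ e, ∀ i ∈ J e, Q e i ⊆ K e) (hc : ∀ e, ∀ i ∈ J e, K (d e i) ⊆ c e i '' Q e i)
    (hg : ∀ e, ∀ i ∈ J e, ∀ t ∈ Q e i, g (γ e t) = γ (d e i) (c e i t))
    (hV : ∀ e, ∀ i ∈ J e, ∀ j ∈ J e, i ≠ j → ∀ x ∈ Q e i, ∀ y ∈ Q e j, (γ e x, γ e y) ∉ V)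
    {L : E → ℝ} {μ B : ℝ} (hB : ∀ e, L e ≤ B) (hμ : 0 ≤ μ)
    (hL : ∀ e, μ * L e ≤ ∑ i ∈ J e, L (d e i)) (k : ℕ) (e : E) :
    ∃ S : Finset ℝ, ↑S ⊆ K e ∧ μ ^ k * L e ≤ S.card * B ∧ ∀ x ∈ S, ∀ y ∈ S, x ≠ y →
      ∃ j < k, (g^[j] (γ e x), g^[j] (γ e y)) ∉ V := by
  classical
  -- A section `σ` of `c e i` pulls the orbits that start in `K (d e i)` back to the piece `Q e i`.
  have hσ : ∀ e, ∀ i ∈ J e, ∃ σ : ℝ → ℝ, ∀ t ∈ K (d e i), σ t ∈ Q e i ∧ c e i (σ t) = t := by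
    intro e i hi
    have : ∀ t, ∃ u, t ∈ K (d e i) → u ∈ Q e i ∧ c e i u = t := fun t => by
      by_cases ht : t ∈ K (d e i)
      · obtain ⟨u, hu⟩ := hc e i hi ht
        exact ⟨u, fun _ => hu⟩
      · exact ⟨0, fun h => absurd h ht⟩
    choose σ hσ using this
    exact ⟨σ, hσ⟩
  choose! σ hσ using hσ
  induction k generalizing e with
  | zero =>
    obtain ⟨t, ht⟩ := hK e
    refine ⟨{t}, by simpa using ht, by simpa using hB e, fun x hx y hy hxy => ?_⟩
    rw [Finset.mem_singleton] at hx hy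
    exact absurd (hx.trans hy.symm) hxy
  | succ k ih =>
    choose S hSK hS hsep using ih
    have hmem : ∀ i ∈ J e, ∀ t ∈ S (d e i), σ e i t ∈ Q e i ∧ c e i (σ e i t) = t :=
      fun i hi t ht => hσ e i hi t (hSK _ ht)
    refine ⟨(J e).biUnion fun i => (S (d e i)).image (σ e i), ?_, ?_, ?_⟩
    · intro x hx
      simp only [Finset.coe_biUnion, Finset.coe_image, mem_iUnion] at hx
      obtain ⟨i, hi, t, ht, rfl⟩ := hx
      exact hQ e i hi (hmem i hi t ht).1
    · rw [Finset.card_biUnion]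
      · have hcard : ∀ i ∈ J e, ((S (d e i)).image (σ e i)).card = (S (d e i)).card := by
          intro i hi
          refine Finset.card_image_of_injOn fun x hx y hy hxy => ?_
          rw [← (hmem i hi x hx).2, ← (hmem i hi y hy).2]
          exact congrArg _ hxy
        rw [Finset.sum_congr rfl hcard, Nat.cast_sum, Finset.sum_mul]
        calc μ ^ (k + 1) * L e = μ ^ k * (μ * L e) := by ring
          _ ≤ μ ^ k * ∑ i ∈ J e, L (d e i) := by gcongr; exact hL e
          _ = ∑ i ∈ J e, μ ^ k * L (d e i) := Finset.mul_sum _ _ _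
          _ ≤ _ := Finset.sum_le_sum fun i _ => hS _
      · intro i hi j hj hij
        refine Finset.disjoint_left.2 fun x hx hy => ?_
        obtain ⟨t, ht, rfl⟩ := Finset.mem_image.1 hx
        obtain ⟨u, hu, hut⟩ := Finset.mem_image.1 hy
        refine hV e i hi j hj hij _ (hmem i hi t ht).1 _ (hut ▸ (hmem j hj u hu).1) ?_
        exact SetRel.rfl V
    · intro x hx y hy hxy
      simp only [Finset.mem_biUnion, Finset.mem_image] at hx hy
      obtain ⟨i, hi, t, ht, rfl⟩ := hx
      obtain ⟨j, hj, u, hu, rfl⟩ := hy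
      obtain ⟨h1, h2⟩ := hmem i hi t ht
      obtain ⟨h3, h4⟩ := hmem j hj u hu
      by_cases hij : i = j
      · subst hij
        obtain ⟨n, hn, hnV⟩ := hsep (d e i) t ht u hu fun h => hxy (congrArg _ h)
        refine ⟨n + 1, Nat.succ_lt_succ hn, ?_⟩
        rwa [Function.iterate_succ_apply, Function.iterate_succ_apply, hg e i hi _ h1,
          hg e i hi _ h3, h2, h4]
      · exact ⟨0, Nat.succ_pos k, hV e i hi j hj hij _ h1 _ h3⟩

/-- Exponentially many separated orbits of an iterate `f^[m]` bound the entropy of `f` from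
below. -/
lemma log_le_mul_coverEntropy {X : Type*} [UniformSpace X] {f : X → X} {m : ℕ} (hm : m ≠ 0)
    {V : SetRel X X} (hV : V ∈ uniformity X) {μ b : ℝ} (hμ : 0 ≤ μ) (hb : 0 < b)
    (h : ∀ k : ℕ, ∃ S : Finset X, b * μ ^ k ≤ S.card ∧ ∀ x ∈ S, ∀ y ∈ S, x ≠ y →
      ∃ j < k, ((f^[m])^[j] x, (f^[m])^[j] y) ∉ V) :
    ENNReal.log (ENNReal.ofReal μ) ≤ m * Dynamics.coverEntropy f (univ : Set X) := by
  obtain ⟨W, hW, hWs, hWV⟩ := comp_symm_mem_uniformity_sets hV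
  have hmono : Monotone fun n => ((Dynamics.netMaxcard f univ W n : ℕ∞) : ENNReal) :=
    fun _ _ hab => ENat.toENNReal_mono (Dynamics.netMaxcard_monotone_time f univ W hab)
  calc ENNReal.log (ENNReal.ofReal μ)
      = ExpGrowth.expGrowthSup fun k => ENNReal.ofReal μ ^ k := ExpGrowth.expGrowthSup_pow.symm
    _ ≤ ExpGrowth.expGrowthSup
          fun k => ((Dynamics.netMaxcard f univ W (m * k) : ℕ∞) : ENNReal) := by
        refine ExpGrowth.expGrowthSup_of_eventually_ge (b := ENNReal.ofReal b) (by simpa using hb)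
          (Filter.Eventually.of_forall fun k => ?_)
        obtain ⟨S, hS, hsep⟩ := h k
        have hnet : Dynamics.IsDynNetIn f univ W (m * k) (S : Set X) := by
          refine ⟨subset_univ _, fun x hx y hy hxy => disjoint_left.2 fun z hxz hyz => ?_⟩
          obtain ⟨j, hj, hjV⟩ := hsep x hx y hy hxy
          rw [Dynamics.mem_ball_dynEntourage] at hxz hyz
          have hlt : m * j < m * k := Nat.mul_lt_mul_of_pos_left hj (Nat.pos_of_ne_zero hm)
          rw [← Function.iterate_mul] at hjV
          exact hjV (hWV ⟨_, hxz _ hlt, SetRel.symm W (hyz _ hlt)⟩)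
        calc ENNReal.ofReal b * ENNReal.ofReal μ ^ k = ENNReal.ofReal (b * μ ^ k) := by
              rw [ENNReal.ofReal_mul hb.le, ENNReal.ofReal_pow hμ]
          _ ≤ ENNReal.ofReal S.card := ENNReal.ofReal_le_ofReal hS
          _ = ((S.card : ℕ∞) : ENNReal) := by simp
          _ ≤ _ := ENat.toENNReal_mono hnet.card_le_netMaxcard
    _ = m * Dynamics.netEntropyEntourage f univ W := hmono.expGrowthSup_comp_mul hm
    _ ≤ m * Dynamics.coverEntropy f (univ : Set X) :=
        mul_le_mul_of_nonneg_left (Dynamics.netEntropyEntourage_le_coverEntropy f univ hW)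
          (by positivity)

end Horseshoe

/-! ### The lower bound -/

section LowerBound

variable {X : Type*} [MetricSpace X] [CWComplex (univ : Set X)]
  {ℓ : EdgeLength X} {f : GraphMap X X} {lam : ℝ}

/-- Dropping the two outermost laps of the `m`-th image of each edge makes the remaining laps a
horseshoe for the `m`-th iterate; the lengths dropped are bounded independently of `m`. -/
lemma GraphMap.IsUniformlyExpanding.log_sub_le_mul_coverEntropy [IsFiniteGraph X]
    [Nonempty (Edge X)] (hf : f.IsUniformlyExpanding ℓ lam) (hlam : 0 < lam) :
    ∃ C : ℝ, ∀ m : ℕ, m ≠ 0 → C ≤ lam ^ m →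
      ENNReal.log (ENNReal.ofReal (lam ^ m - C)) ≤
        m * Dynamics.coverEntropy f.toFun (univ : Set X) := by
  have := finite_cell (X := X) 1
  obtain ⟨e₀, hmin⟩ := Finite.exists_min ℓ.length
  obtain ⟨e₁, hmax⟩ := Finite.exists_max ℓ.length
  -- At most two laps are dropped, of length at most `B` each; relative to the length of the edge
  -- this costs at most `C = 2 * B / ℓ.length e₀`.
  set B := ℓ.length e₁
  have hB : 0 < B := ℓ.length_pos e₁
  have hb : 0 < ℓ.length e₀ := ℓ.length_pos e₀
  refine ⟨2 * B / ℓ.length e₀, fun m hm hC => ?_⟩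
  set C := 2 * B / ℓ.length e₀ with hCdef
  have hCe : ∀ e, 2 * B ≤ C * ℓ.length e := fun e => by
    have h1 : C * ℓ.length e₀ = 2 * B := div_mul_cancel₀ _ hb.ne'
    have h2 : 0 ≤ C := by positivity
    rw [← h1]
    exact mul_le_mul_of_nonneg_left (hmin e) h2
  choose P hP using hf.exists_laps_iterate m
  have hpos : ∀ e, 0 < (P e).totalLength ℓ := fun e => by
    rw [hP]
    exact mul_pos (pow_pos hlam m) (ℓ.length_pos e)
  choose p q hpq hsub J hJ hJL using fun e => (P e).exists_inner hmax (hpos e)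
  choose Q hQdom hQcomp hQ using fun e (i : (P e).ι) =>
    (P e).exists_isCompact i (hpq ((P e).edge i)) (hsub ((P e).edge i))
  have hQIoo : ∀ e i, Q e i ⊆ Ioo (-1) 1 := fun e i => (hQdom e i).trans ((P e).dom_subset i)
  have hsep : ∀ e, ∃ V ∈ uniformity X, ∀ i j, i ≠ j → ∀ x ∈ edgeMap e '' Q e i,
      ∀ y ∈ edgeMap e '' Q e j, (x, y) ∉ V := fun e =>
    exists_mem_uniformity_separating
      (fun i => (hQcomp e i).image_of_continuousOn
        ((continuousOn_edgeMap e).mono ((hQIoo e i).trans Ioo_subset_Icc_self)))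
      fun i j hij => disjoint_image_image fun x hx y hy hxy =>
        disjoint_left.1 ((P e).disjoint i j hij) (hQdom e i hx)
          (injOn_edgeMap e (hQIoo e i hx) (hQIoo e j hy) hxy ▸ hQdom e j hy)
  choose V hV hVs using hsep
  have hVmem : ⋂ e, V e ∈ uniformity X := Filter.iInter_mem.2 hV
  have : SetRel.IsRefl (⋂ e, V e) := isRefl_of_mem_uniformity hVmem
  have hμ : 0 ≤ lam ^ m - C := sub_nonneg.2 hC
  refine log_le_mul_coverEntropy hm hVmem hμ (div_pos hb hB) fun k => ?_
  obtain ⟨S, hSK, hS, hSsep⟩ := exists_separated_of_horseshoe (g := f.toFun^[m])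
    (γ := fun e : Edge X => edgeMap e) (K := fun e => Icc (p e) (q e)) (V := ⋂ e, V e)
    (ι := fun e => (P e).ι) (J := J) (d := fun e => (P e).edge) (c := fun e => (P e).coord)
    (Q := Q) (fun e => nonempty_Icc.2 (hpq e)) (fun e i hi => (hQdom e i).trans (hJ e i hi))
    (fun e i _ => hQ e i) (fun e i _ t ht => (P e).eq_edgeMap i t (hQdom e i ht))
    (fun e i _ j _ hij x hx y hy hxy => hVs e i j hij _ (mem_image_of_mem _ hx) _
      (mem_image_of_mem _ hy) (mem_iInter.1 hxy e))
    (L := ℓ.length) hmax hμ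
    (fun e => by
      have h1 := hJL e
      have h2 := hCe e
      rw [hP] at h1
      linarith) k e₀
  classical
  refine ⟨S.image (edgeMap e₀), ?_, ?_⟩
  · rw [Finset.card_image_of_injOn ((injOn_edgeMap e₀).mono (hSK.trans (hsub e₀))),
      div_mul_eq_mul_div, div_le_iff₀ hB, mul_comm]
    exact hS
  · intro x hx y hy hxy
    obtain ⟨t, ht, rfl⟩ := Finset.mem_image.1 hx
    obtain ⟨u, hu, rfl⟩ := Finset.mem_image.1 hy
    exact hSsep t ht u hu fun h => hxy (congrArg _ h)

lemma GraphMap.IsUniformlyExpanding.le_coverEntropy [IsFiniteGraph X] [Nonempty (Edge X)]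
    (hf : f.IsUniformlyExpanding ℓ lam) (hlam : 0 < lam) :
    ENNReal.log (ENNReal.ofReal lam) ≤ Dynamics.coverEntropy f.toFun (univ : Set X) := by
  rcases (hf.one_le hlam).eq_or_lt with rfl | hlam1
  -- For `lam = 1` the bound `lam ^ m - C` is useless, but the entropy is nonnegative anyway.
  · obtain ⟨e⟩ := ‹Nonempty (Edge X)›
    simpa using Dynamics.coverEntropy_nonneg f.toFun ⟨edgeMap e 0, mem_univ _⟩
  obtain ⟨C, hC⟩ := hf.log_sub_le_mul_coverEntropy hlam
  have key : ∀ μ ∈ Ioo 0 lam, ENNReal.log (ENNReal.ofReal μ) ≤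
      Dynamics.coverEntropy f.toFun (univ : Set X) := by
    rintro μ ⟨hμ0, hμ⟩
    -- For large `m`, the number `lam ^ m - C` is at least `μ ^ m`.
    have hdiff : Filter.Tendsto (fun m : ℕ => lam ^ m * (1 - (μ / lam) ^ m)) Filter.atTop
        Filter.atTop := by
      refine (tendsto_pow_atTop_atTop_of_one_lt hlam1).atTop_mul_pos (C := 1 - 0) (by norm_num) ?_
      refine tendsto_const_nhds.sub (tendsto_pow_atTop_nhds_zero_of_lt_one (by positivity) ?_)
      rwa [div_lt_one hlam]
    obtain ⟨m, hmC, hm⟩ := ((hdiff.eventually_ge_atTop C).and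
      (Filter.eventually_ne_atTop 0)).exists
    have hpow : lam ^ m * (1 - (μ / lam) ^ m) = lam ^ m - μ ^ m := by
      rw [div_pow]
      field_simp
    rw [hpow] at hmC
    have hμm : 0 < μ ^ m := pow_pos hμ0 m
    have h1 : ENNReal.log (ENNReal.ofReal (μ ^ m)) ≤
        m * Dynamics.coverEntropy f.toFun (univ : Set X) :=
      (ENNReal.log_monotone (ENNReal.ofReal_le_ofReal (by linarith))).trans
        (hC m hm (by linarith))
    have hm0 : (0 : ℝ) < m := by exact_mod_cast Nat.pos_of_ne_zero hm
    have hm0' : (0 : EReal) < m := by exact_mod_cast Nat.pos_of_ne_zero hm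
    rw [ENNReal.log_ofReal_of_pos hμm, Real.log_pow,
      ← EReal.div_le_iff_le_mul hm0' (EReal.natCast_ne_top m)] at h1
    rw [ENNReal.log_ofReal_of_pos hμ0]
    refine le_of_eq_of_le ?_ h1
    rw [← EReal.coe_natCast, ← EReal.coe_div, mul_div_cancel_left₀ _ hm0.ne']
  have hlim : Filter.Tendsto (fun μ : ℝ => ENNReal.log (ENNReal.ofReal μ)) (𝓝[<] lam)
      (𝓝 (ENNReal.log (ENNReal.ofReal lam))) :=
    ((ENNReal.continuous_log.comp ENNReal.continuous_ofReal).tendsto lam).mono_left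
      nhdsWithin_le_nhds
  exact le_of_tendsto hlim (Filter.eventually_of_mem (Ioo_mem_nhdsLT hlam) key)

end LowerBound

end MetricGraphEntropy

theorem mainTheorem11 {X : Type*} [MetricSpace X] [CWComplex (univ : Set X)]
    [MetricGraphEntropy.IsFiniteGraph X] [Nonempty (MetricGraphEntropy.Edge X)]
    (ℓ : MetricGraphEntropy.EdgeLength X) (f : MetricGraphEntropy.GraphMap X X)
    (lam : ℝ) (hlam_pos : 0 < lam) (hlam_int : IsIntegral ℤ lam)
    (hf : f.IsUniformlyExpanding ℓ lam) :
    Dynamics.coverEntropy f.toFun (univ : Set X) = ((Real.log lam : ℝ) : EReal) := by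
  rw [← ENNReal.log_ofReal_of_pos hlam_pos]
  exact le_antisymm (hf.coverEntropy_le hlam_pos) (hf.le_coverEntropy hlam_pos)
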